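/- Let $X$ be the wedge of $n=2$ circles, so $\pi_1(X)\cong F_2$. There are coverings of finite connected graphs $Y \xrightarrow{p_2} Z \xrightarrow{p_1} X$, where $p_1$ and $p_2$ are the mod-$2$ homology coverings of $X$ and of $Z$ respectively (the mod-$m$ homology covering of a connected graph $W$ is the connected covering corresponding to the kernel of $\pi_1(W)\to H_1(W;\mathbb{Z}/m\mathbb{Z})$), such that the composite $p=p_1\circ p_2\colon Y\to X$ is a finite regular covering, and there is an indivisible class $z\in H_1(Y;\mathbb{Z})$ (that is, $z = m z_0$ with $m\in\mathbb{Z}$, $z_0\in H_1(Y;\mathbb{Z})$ implies $m=\pm1$) with $p_*(z)=0\in H_1(X;\mathbb{Z})$, such that, writing $G$ for the deck group of $p$: (i) there is $g\in G$ such that $\mathrm{Span}_{\mathbb{C}[G]}\{z\}\subseteq H_1(Y;\mathbb{C})$ is isomorphic, as a $G$-representation, to $\mathrm{Ind}_{\langle g\rangle}^G(\mathbb{C}_{\mathrm{triv}})/\mathbb{C}_{\mathrm{triv}}$, the quotient by an embedded copy of the trivial one-dimensional representation; (ii) $z$ is not the homology class of an elevation of a primitive commutator of $\pi_1(X)$.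 Here a primitive commutator is an element $[w,w']=ww'w^{-1}w'^{-1}$ with $w,w'$ elements of a common free basis of $\pi_1(X)$, and an elevation of a loop $l$ in $X$ at a vertex $y$ of $Y$ is the closed lift at $y$ of $l^k$, where $k\ge 1$ is the smallest number for which the lift of $l^k$ at $y$ is closed. -/

import Mathlib

/-- An oriented graph (a 1-dimensional CW complex whose 1-cells carry an orientation); loops and
multiple edges are allowed. -/
structure OGraph where
  /-- vertices -/
  V : Type
  /-- (oriented) edges -/
  E : Type
  /-- initial vertex of an edge -/
  src : E → V
  /-- terminal vertex of an edge -/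
  tgt : E → V

namespace OGraph

/-- The wedge of circles indexed by `ι`: one vertex and one loop for every element of `ι`. -/
abbrev rose (ι : Type) : OGraph where
  V := Unit
  E := ι
  src := fun _ => ()
  tgt := fun _ => ()

/-- Initial vertex of a step: `(e, true)` traverses the edge `e` forwards, `(e, false)`
backwards. -/
def stepStart (Y : OGraph) (s : Y.E × Bool) : Y.V := if s.2 then Y.src s.1 else Y.tgt s.1

/-- Terminal vertex of a step. -/
def stepEnd (Y : OGraph) (s : Y.E × Bool) : Y.V := if s.2 then Y.tgt s.1 else Y.src s.1

/-- `Y.IsWalk u γ v`: the list of steps `γ` is an edge path in `Y` from `u` to `v`. -/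
def IsWalk (Y : OGraph) : Y.V → List (Y.E × Bool) → Y.V → Prop
  | u, [], v => u = v
  | u, s :: γ, v => Y.stepStart s = u ∧ IsWalk Y (Y.stepEnd s) γ v

/-- Nonempty and path-connected. -/
def Connected (Y : OGraph) : Prop := Nonempty Y.V ∧ ∀ u v : Y.V, ∃ γ, Y.IsWalk u γ v

/-- A morphism of oriented graphs. -/
structure Hom (Y X : OGraph) where
  onV : Y.V → X.V
  onE : Y.E → X.E
  src_onE : ∀ e, X.src (onE e) = onV (Y.src e)
  tgt_onE : ∀ e, X.tgt (onE e) = onV (Y.tgt e)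

/-- Composition of morphisms. -/
def Hom.comp {Y Z X : OGraph} (p : Hom Z X) (q : Hom Y Z) : Hom Y X where
  onV := p.onV ∘ q.onV
  onE := p.onE ∘ q.onE
  src_onE e := by simp [p.src_onE, q.src_onE]
  tgt_onE e := by simp [p.tgt_onE, q.tgt_onE]

/-- The image of an edge path. -/
def Hom.mapWalk {Y X : OGraph} (p : Hom Y X) (γ : List (Y.E × Bool)) : List (X.E × Bool) :=
  γ.map fun s => (p.onE s.1, s.2)

/-- A covering of graphs: a morphism that is bijective on the half-edges at every vertex. -/
def Hom.IsCovering {Y X : OGraph} (p : Hom Y X) : Prop :=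
  (∀ (v : Y.V) (e : X.E), X.src e = p.onV v → ∃! f : Y.E, Y.src f = v ∧ p.onE f = e) ∧
  (∀ (v : Y.V) (e : X.E), X.tgt e = p.onV v → ∃! f : Y.E, Y.tgt f = v ∧ p.onE f = e)

/-- The deck group of `p : Y → X`: the automorphisms of `Y` over `X`. -/
def Hom.deck {Y X : OGraph} (p : Hom Y X) : Subgroup (Equiv.Perm Y.V × Equiv.Perm Y.E) where
  carrier := {g | (∀ e, Y.src (g.2 e) = g.1 (Y.src e)) ∧ (∀ e, Y.tgt (g.2 e) = g.1 (Y.tgt e)) ∧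
    (∀ v, p.onV (g.1 v) = p.onV v) ∧ (∀ e, p.onE (g.2 e) = p.onE e)}
  one_mem' := by simp
  mul_mem' := by
    rintro a b ⟨h1, h2, h3, h4⟩ ⟨k1, k2, k3, k4⟩
    simp [h1, h2, h3, h4, k1, k2, k3, k4]
  inv_mem' := by
    rintro a ⟨h1, h2, h3, h4⟩
    refine ⟨fun e => ?_, fun e => ?_, fun v => ?_, fun e => ?_⟩
    · have := h1 (a.2⁻¹ e)
      simp at this
      simp [this]
    · have := h2 (a.2⁻¹ e)
      simp at this
      simp [this]
    · simpa using (h3 (a.1⁻¹ v)).symm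
    · simpa using (h4 (a.2⁻¹ e)).symm

/-- A regular covering: a covering of connected graphs whose deck group acts transitively on the
fibres. -/
def Hom.IsRegularCovering {Y X : OGraph} (p : Hom Y X) : Prop :=
  p.IsCovering ∧ Y.Connected ∧ X.Connected ∧
    ∀ u v : Y.V, p.onV u = p.onV v → ∃ g ∈ p.deck, g.1 u = v

section Homology

variable (R : Type) [CommRing R]

/-- The cellular boundary map `C₁(Y; R) → C₀(Y; R)`, `e ↦ tgt e - src e`. -/
noncomputable def boundary (Y : OGraph) : (Y.E →₀ R) →ₗ[R] (Y.V →₀ R) :=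
  Finsupp.linearCombination R
    fun e => Finsupp.single (Y.tgt e) (1 : R) - Finsupp.single (Y.src e) (1 : R)

/-- The first homology `H₁(Y; R)`: the 1-cycles (there are no 2-cells). -/
noncomputable abbrev H1 (Y : OGraph) : Submodule R (Y.E →₀ R) := LinearMap.ker (boundary R Y)

/-- The 1-chain of an edge path. -/
noncomputable def chain (Y : OGraph) (γ : List (Y.E × Bool)) : Y.E →₀ R :=
  (γ.map fun s => Finsupp.single s.1 (if s.2 then (1 : R) else -1)).sum

theorem boundary_chain (Y : OGraph) (γ : List (Y.E × Bool)) (u v : Y.V) (h : Y.IsWalk u γ v) :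
    boundary R Y (chain R Y γ) = Finsupp.single v 1 - Finsupp.single u 1 := by
  induction γ generalizing u with
  | nil =>
    have h' : u = v := h
    simp [chain, h']
  | cons s γ ih =>
    obtain ⟨h1, h2⟩ := h
    have h3 := ih _ h2
    have h4 : chain R Y (s :: γ)
        = Finsupp.single s.1 (if s.2 then (1 : R) else -1) + chain R Y γ := by
      simp [chain]
    rw [h4, map_add, h3]
    obtain ⟨e, b⟩ := s
    cases b
    · simp only [stepStart, stepEnd] at h1 ⊢
      simp [boundary, ← h1]
    · simp only [stepStart, stepEnd] at h1 ⊢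
      simp [boundary, ← h1]

/-- The homology class of a closed edge path. -/
noncomputable def loopClass (Y : OGraph) (γ : List (Y.E × Bool)) (v : Y.V) (h : Y.IsWalk v γ v) :
    H1 R Y :=
  ⟨chain R Y γ, by simp [boundary_chain R Y γ v v h]⟩

/-- The map on 1-chains induced by a morphism. -/
noncomputable def Hom.chainMap {Y X : OGraph} (p : Hom Y X) : (Y.E →₀ R) →ₗ[R] (X.E →₀ R) :=
  Finsupp.lmapDomain R R p.onE

theorem Hom.boundary_chainMap {Y X : OGraph} (p : Hom Y X) (c : Y.E →₀ R) :
    boundary R X (p.chainMap R c) = Finsupp.lmapDomain R R p.onV (boundary R Y c) := by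
  induction c using Finsupp.induction_linear with
  | zero => simp
  | add f g hf hg => rw [map_add, map_add, hf, hg, map_add, map_add]
  | single e a =>
    simp [Hom.chainMap, boundary, p.src_onE, p.tgt_onE, Finsupp.mapDomain_single, smul_sub,
      Finsupp.mapDomain_sub]

/-- The map `p_* : H₁(Y; R) → H₁(X; R)` induced by a morphism. -/
noncomputable def Hom.mapH1 {Y X : OGraph} (p : Hom Y X) : H1 R Y →ₗ[R] H1 R X :=
  (p.chainMap R).restrict fun c hc => by
    have hc' : boundary R Y c = 0 := hc
    change boundary R X (p.chainMap R c) = 0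
    rw [p.boundary_chainMap R c, hc', map_zero]

/-- The image of an integral homology class in homology with coefficients in `R`. -/
noncomputable def fromInt (Y : OGraph) (z : H1 ℤ Y) : H1 R Y :=
  ⟨Finsupp.mapRange (Int.cast : ℤ → R) Int.cast_zero (z : Y.E →₀ ℤ), by
    have key : ∀ c : Y.E →₀ ℤ,
        boundary R Y (Finsupp.mapRange (Int.cast : ℤ → R) Int.cast_zero c)
          = Finsupp.mapRange (Int.cast : ℤ → R) Int.cast_zero (boundary ℤ Y c) := by
      intro c
      induction c using Finsupp.induction_linear with
      | zero => simp
      | add f g hf hg =>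
        rw [Finsupp.mapRange_add Int.cast_add, map_add, map_add, hf, hg,
          Finsupp.mapRange_add Int.cast_add]
      | single e a =>
        simp [boundary, Finsupp.mapRange_single, smul_sub, Finsupp.mapRange_sub]
    have hz : boundary ℤ Y (z : Y.E →₀ ℤ) = 0 := z.2
    rw [LinearMap.mem_ker, key, hz, Finsupp.mapRange_zero]⟩

/-- A deck transformation as a morphism. -/
def Hom.deckHom {Y X : OGraph} (p : Hom Y X) (g : p.deck) : Hom Y Y where
  onV := g.1.1
  onE := g.1.2
  src_onE := g.2.1
  tgt_onE := g.2.2.1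

/-- The action of the deck group on `H₁(Y; R)`. -/
noncomputable def Hom.deckRep {Y X : OGraph} (p : Hom Y X) :
    Representation R p.deck (H1 R Y) where
  toFun g := (p.deckHom g).mapH1 R
  map_one' := by
    ext c : 2
    exact Finsupp.mapDomain_id
  map_mul' g h := by
    ext c : 2
    exact Finsupp.mapDomain_comp (f := (p.deckHom h).onE) (g := (p.deckHom g).onE)

end Homology

/-- The mod-`m` homology covering: a connected covering `p : Y → X` such that `p_* π₁(Y)` is the
kernel of `π₁(X) → H₁(X; ℤ/m)`, that is, an edge path of `Y` lying over a loop of `X` is closed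
if and only if that loop is trivial in `H₁(X; ℤ/m)`. -/
def Hom.IsModHomologyCovering {Y X : OGraph} (m : ℕ) (p : Hom Y X) : Prop :=
  p.IsCovering ∧ Y.Connected ∧ X.Connected ∧
    ∀ (u v : Y.V) (γ : List (Y.E × Bool)), Y.IsWalk u γ v →
      ∀ h : X.IsWalk (p.onV u) (p.mapWalk γ) (p.onV u),
        (u = v ↔ loopClass (ZMod m) X (p.mapWalk γ) (p.onV u) h = 0)

/-- The closed edge path `γ` of `Y` at `y` is an elevation of the loop `w` of `X`: it is the lift
at `y` of `w ^ k`, where `k` is the smallest positive number for which that lift is closed. -/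
def Hom.IsElevation {Y X : OGraph} (p : Hom Y X) (w : List (X.E × Bool)) (y : Y.V)
    (γ : List (Y.E × Bool)) : Prop :=
  Y.IsWalk y γ y ∧ ∃ k : ℕ, 0 < k ∧ p.mapWalk γ = (List.replicate k w).flatten ∧
    ∀ j : ℕ, 0 < j → j < k → ∀ δ : List (Y.E × Bool),
      p.mapWalk δ = (List.replicate j w).flatten → ¬ Y.IsWalk y δ y

end OGraph

/-- A primitive commutator: the commutator of two elements of a free basis. -/
def IsPrimitiveCommutator {F : Type} [Group F] (c : F) : Prop :=
  ∃ (ι : Type) (b : FreeGroupBasis ι F) (i j : ι), c = b i * b j * (b i)⁻¹ * (b j)⁻¹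

/-- The subrepresentation `Span_{ℂ[G]} {v}` generated by `v`. -/
noncomputable def orbitSpan {G W : Type} [Group G] [AddCommGroup W] [Module ℂ W]
    (ρ : Representation ℂ G W) (v : W) : Subrepresentation ρ where
  toSubmodule := Submodule.span ℂ (Set.range fun g => ρ g v)
  apply_mem_toSubmodule g x hx := by
    induction hx using Submodule.span_induction with
    | mem x hx =>
      obtain ⟨h, rfl⟩ := hx
      exact Submodule.subset_span ⟨g * h, by simp⟩
    | zero => simp
    | add x y _ _ hx hy => simpa using add_mem hx hy
    | smul a x _ hx => simpa using Submodule.smul_mem _ a hx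

/-- The induced representation `Ind_{⟨g⟩}^G (ℂ_triv)`. -/
noncomputable abbrev indTriv {G : Type} [Group G] (g : G) :=
  Representation.ind (Subgroup.zpowers g).subtype
    (Representation.trivial ℂ (Subgroup.zpowers g) ℂ)

/-- `σ` is isomorphic to the quotient `τ / ℂ_triv` of `τ` by an embedded copy of the trivial
one-dimensional representation. -/
def IsIsoQuotientByTriv {G W U : Type} [Group G] [AddCommGroup W] [Module ℂ W]
    [AddCommGroup U] [Module ℂ U] (σ : Representation ℂ G W) (τ : Representation ℂ G U) : Prop :=
  ∃ i : (Representation.trivial ℂ G ℂ).IntertwiningMap τ, Function.Injective i ∧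
    Nonempty (σ.Equiv (τ.quotient i.range.toSubmodule
      fun g _ hx => i.range.apply_mem_toSubmodule g hx))

/-! `Y` is the Cayley graph of the deck group `G`, generated by the images `x`, `x'` of the two
circles. Let `e` be the cycle formed by the `x`-edges at `⟨x⟩`. The class is `z = [G : ⟨x⟩] e - (sum
of all distinct translates of e)`. Its coefficients sum to zero, so it dies in `X`. It has a
coefficient `-1`, because `x' ∉ ⟨x⟩`, so it is indivisible. The translates of `e` have disjoint
supports and span a copy of `Ind`. Those of `z` span its quotient by the invariant line
(`isIsoQuotientByTriv_orbitSpan`).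

To exclude elevations of `c = [b i, b j]` with `i ≠ j`, choose `f : F₂ → ℤ ⋊ {±1}` sending the first
generator to a reflection and `c` to a nonzero translation (`exists_hom_affineInt`). The sign of `f`
factors through mod-2 homology, so it is a function on the vertices of `Y`, and the translation part
of `f` along a path is a linear functional of its chain (`IsWalk.action_apply`). This functional
kills `z`: the coefficients are invariant under right translation by `x`, while the weights of the
`x`-edges change sign. On an elevation of `c` it is, up to sign, `k` times a nonzero integer. If `i
= j`, then `c = 1` and the elevation has zero chain. -/

/-! ### Representations induced from the trivial representation of a cyclic subgroup. -/

section InducedTrivial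

variable {G W : Type} [Group G] [AddCommGroup W] [Module ℂ W]

/-- The basis-like vector of `Ind_{⟨g⟩}^G (ℂ_triv)` attached to the coset `h⟨g⟩`. -/
noncomputable def indTrivVec (g h : G) :
    Representation.IndV (Subgroup.zpowers g).subtype
      (Representation.trivial ℂ (Subgroup.zpowers g) ℂ) :=
  Representation.IndV.mk _ _ h⁻¹ 1

theorem indTriv_indTrivVec (g h k : G) : indTriv g h (indTrivVec g k) = indTrivVec g (h * k) := by
  rw [indTrivVec, Representation.ind_mk, indTrivVec, mul_inv_rev]

theorem indTrivVec_mul (g h k : G) (hk : k ∈ Subgroup.zpowers g) :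
    indTrivVec g (h * k) = indTrivVec g h := by
  have := Representation.Coinvariants.mk_inv_tmul
    (ρ := (Representation.leftRegular ℂ G).comp (Subgroup.zpowers g).subtype)
    (τ := Representation.trivial ℂ (Subgroup.zpowers g) ℂ)
    (MonoidAlgebra.single h⁻¹ 1) 1 ⟨k, hk⟩
  simpa [indTrivVec] using this

theorem span_range_indTrivVec (g : G) : Submodule.span ℂ (Set.range (indTrivVec g)) = ⊤ := by
  rw [← Submodule.ker_mkQ (Submodule.span ℂ (Set.range (indTrivVec g))), LinearMap.ker_eq_top]
  refine Representation.IndV.hom_ext _ _ fun h => LinearMap.ext_ring ?_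
  rw [LinearMap.zero_comp, LinearMap.zero_apply, LinearMap.comp_apply, Submodule.mkQ_apply,
    Submodule.Quotient.mk_eq_zero]
  exact Submodule.subset_span ⟨h⁻¹, by simp [indTrivVec]⟩

theorem apply_eq_self_of_mem_zpowers (ρ : Representation ℂ G W) {g k : G} {v : W}
    (hv : ρ g v = v) (hk : k ∈ Subgroup.zpowers g) : ρ k v = v := by
  let S : Subgroup G :=
    { carrier := {k | ρ k v = v}
      one_mem' := by simp
      mul_mem' := fun {a b} (ha : ρ a v = v) (hb : ρ b v = v) => by
        change ρ (a * b) v = v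
        rw [map_mul, Module.End.mul_apply, hb, ha]
      inv_mem' := fun {a} (ha : ρ a v = v) => by
        change ρ a⁻¹ v = v
        nth_rewrite 1 [← ha]
        simp }
  exact (Subgroup.zpowers_le (H := S)).2 hv hk

/-- The linear map out of `Ind_{⟨g⟩}^G (ℂ_triv)` determined by a vector fixed by `g`. -/
noncomputable def indTrivLift (ρ : Representation ℂ G W) (g : G) (v : W) (hv : ρ g v = v) :
    Representation.IndV (Subgroup.zpowers g).subtype
      (Representation.trivial ℂ (Subgroup.zpowers g) ℂ) →ₗ[ℂ] W :=
  Representation.Coinvariants.lift _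
    (TensorProduct.lift <| (Finsupp.lift _ _ _ fun h => LinearMap.toSpanSingleton ℂ W (ρ h⁻¹ v)) ∘ₗ
      (MonoidAlgebra.coeffLinearEquiv ℂ).toLinearMap) fun k => by
    ext h
    simp [apply_eq_self_of_mem_zpowers ρ hv (inv_mem k.2)]

theorem indTrivLift_indTrivVec (ρ : Representation ℂ G W) (g : G) (v : W) (hv : ρ g v = v)
    (h : G) : indTrivLift ρ g v hv (indTrivVec g h) = ρ h v := by
  simp [indTrivLift, indTrivVec]

theorem indTrivLift_indTriv (ρ : Representation ℂ G W) (g : G) (v : W) (hv : ρ g v = v) (h : G)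
    (a) : indTrivLift ρ g v hv (indTriv g h a) = ρ h (indTrivLift ρ g v hv a) := by
  have ha : a ∈ Submodule.span ℂ (Set.range (indTrivVec g)) := by
    rw [span_range_indTrivVec]; trivial
  induction ha using Submodule.span_induction with
  | mem x hx =>
    obtain ⟨k, rfl⟩ := hx
    rw [indTriv_indTrivVec, indTrivLift_indTrivVec, indTrivLift_indTrivVec, map_mul,
      Module.End.mul_apply]
  | zero => simp only [map_zero]
  | add x y _ _ hx hy => simp only [map_add, hx, hy]
  | smul c x _ hx => simp only [map_smul, hx]

theorem range_indTrivLift (ρ : Representation ℂ G W) (g : G) (v : W) (hv : ρ g v = v) :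
    LinearMap.range (indTrivLift ρ g v hv) = (orbitSpan ρ v).toSubmodule := by
  rw [LinearMap.range_eq_map, ← span_range_indTrivVec, Submodule.map_span, ← Set.range_comp]
  change _ = Submodule.span ℂ _
  congr 2
  funext h
  exact indTrivLift_indTrivVec ρ g v hv h

/-- The inclusion of the trivial representation in `Ind_{⟨g⟩}^G (ℂ_triv)`. -/
noncomputable def trivToIndTriv [Fintype G] (g : G) :
    (Representation.trivial ℂ G ℂ).IntertwiningMap (indTriv g) :=
  LinearMap.intertwiningMap_of_isIntertwiningMap _ _
    (LinearMap.toSpanSingleton ℂ _ (∑ d, indTrivVec g d)) fun h c => by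
    have key : indTriv g h (∑ d, indTrivVec g d) = ∑ d, indTrivVec g d := by
      rw [map_sum]
      simp only [indTriv_indTrivVec]
      exact Equiv.sum_comp (Equiv.mulLeft h) (indTrivVec g)
    rw [LinearMap.toSpanSingleton_apply, LinearMap.toSpanSingleton_apply, map_smul, key]
    simp

theorem trivToIndTriv_apply [Fintype G] (g : G) (c : ℂ) :
    trivToIndTriv g c = c • ∑ d, indTrivVec g d := rfl

/-- The augmentation, that is, the lift of the fixed vector `1` of the trivial representation, sends
the image of `c` to `c * |G|`. -/
theorem trivToIndTriv_injective [Fintype G] (g : G) : Function.Injective (trivToIndTriv g) := by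
  have h1 (c : ℂ) : indTrivLift (Representation.trivial ℂ G ℂ) g 1 (by simp)
      (trivToIndTriv g c) = c * Fintype.card G := by
    rw [trivToIndTriv_apply, map_smul, map_sum]
    simp [indTrivLift_indTrivVec]
  intro a b hab
  have h2 := h1 a
  rw [hab, h1 b] at h2
  exact (mul_right_cancel₀ (Nat.cast_ne_zero.2 Fintype.card_ne_zero) h2).symm

/-- A vector `v` fixed by `g` whose translates sum to zero and are separated by a linear functional
generates a copy of `Ind_{⟨g⟩}^G (ℂ_triv) / ℂ_triv`. -/
theorem isIsoQuotientByTriv_orbitSpan [Fintype G] (ρ : Representation ℂ G W) (g : G) (v : W)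
    (hv : ρ g v = v) (hsum : ∑ d, ρ d v = 0) (l : W →ₗ[ℂ] ℂ)
    (hl : ∀ d ∈ Subgroup.zpowers g, l (ρ d v) = (Subgroup.zpowers g).index - 1)
    (hl' : ∀ d ∉ Subgroup.zpowers g, l (ρ d v) = -1) :
    IsIsoQuotientByTriv (orbitSpan ρ v).toRepresentation (indTriv g) := by
  classical
  refine ⟨trivToIndTriv g, trivToIndTriv_injective g, ?_⟩
  -- Averaging `l` over `G` gives an equivariant-style inverse of `indTrivLift` up to the factor
  -- `|G|` and modulo the invariant line.
  let S := ∑ d, LinearMap.toSpanSingleton ℂ _ (indTrivVec g d) ∘ₗ l ∘ₗ ρ d⁻¹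
  have hS (h : G) : S (ρ h v) = (Fintype.card G : ℂ) • indTrivVec g h - ∑ d, indTrivVec g d := by
    have h1 (d : G) : l (ρ d v) =
        (if d ∈ Subgroup.zpowers g then ((Subgroup.zpowers g).index : ℂ) else 0) - 1 := by
      split_ifs with hd
      · exact hl d hd
      · simp [hl' d hd]
    have h2 : S (ρ h v) = ∑ d, l (ρ (d⁻¹ * h) v) • indTrivVec g d := by
      simp [S]
    rw [h2]
    simp only [h1, sub_smul, one_smul, Finset.sum_sub_distrib]
    congr 1
    -- With `d = h * k`, only `k ∈ ⟨g⟩` contributes. All these terms are the same vector, and `|⟨g⟩|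
    -- * [G : ⟨g⟩] = |G|`.
    rw [← Equiv.sum_comp (Equiv.mulLeft h)]
    simp only [Equiv.coe_mulLeft, mul_inv_rev, inv_mul_cancel_right, inv_mem_iff]
    have h3 (k : G) : (if k ∈ Subgroup.zpowers g then ((Subgroup.zpowers g).index : ℂ) else 0) •
        indTrivVec g (h * k) = (if k ∈ Subgroup.zpowers g then
          ((Subgroup.zpowers g).index : ℂ) else 0) • indTrivVec g h := by
      split_ifs with hk
      · rw [indTrivVec_mul g h k hk]
      · simp only [zero_smul]
    rw [Finset.sum_congr rfl fun k _ => h3 k, ← Finset.sum_smul, ← Finset.sum_filter,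
      Finset.sum_const, nsmul_eq_mul, ← Nat.cast_mul]
    congr 2
    rw [← Nat.card_eq_fintype_card, ← (Subgroup.zpowers g).card_mul_index]
    congr 1
    rw [Nat.card_eq_fintype_card, Fintype.card_subtype]
  have hker : LinearMap.ker (indTrivLift ρ g v hv) = (trivToIndTriv g).range.toSubmodule := by
    apply le_antisymm
    · intro a ha
      -- `hS` extended linearly. On the kernel the left side vanishes, which puts `a` on the
      -- invariant line.
      have h1 : ∀ a, ∃ t : ℂ, S (indTrivLift ρ g v hv a) =
          (Fintype.card G : ℂ) • a - t • ∑ d, indTrivVec g d := fun a => by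
        have ha : a ∈ Submodule.span ℂ (Set.range (indTrivVec g)) := by
          rw [span_range_indTrivVec]; trivial
        induction ha using Submodule.span_induction with
        | mem x hx =>
          obtain ⟨k, rfl⟩ := hx
          exact ⟨1, by rw [indTrivLift_indTrivVec, hS, one_smul]⟩
        | zero => exact ⟨0, by simp only [map_zero, smul_zero, zero_smul, sub_zero]⟩
        | add x y _ _ hx hy =>
          obtain ⟨t, ht⟩ := hx
          obtain ⟨u, hu⟩ := hy
          exact ⟨t + u, by rw [map_add, map_add, ht, hu]; module⟩
        | smul c x _ hx =>
          obtain ⟨t, ht⟩ := hx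
          exact ⟨c * t, by rw [map_smul, map_smul, ht]; module⟩
      obtain ⟨t, ht⟩ := h1 a
      rw [LinearMap.mem_ker.1 ha, map_zero, eq_comm, sub_eq_zero] at ht
      have h0 : (Fintype.card G : ℂ) ≠ 0 := Nat.cast_ne_zero.2 Fintype.card_ne_zero
      refine ⟨(Fintype.card G : ℂ)⁻¹ * t, ?_⟩
      change ((Fintype.card G : ℂ)⁻¹ * t) • ∑ d, indTrivVec g d = a
      rw [mul_smul, ← ht, smul_smul, inv_mul_cancel₀ h0, one_smul]
    · rintro _ ⟨c, rfl⟩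
      change indTrivLift ρ g v hv (c • ∑ d, indTrivVec g d) = 0
      rw [map_smul, map_sum, Finset.sum_congr rfl fun d _ => indTrivLift_indTrivVec ρ g v hv d,
        hsum, smul_zero]
  let e := (Submodule.quotEquivOfEq _ _ hker.symm).trans
    ((indTrivLift ρ g v hv).quotKerEquivRange.trans
      (LinearEquiv.ofEq _ _ (range_indTrivLift ρ g v hv)))
  refine ⟨(Representation.Equiv.mk e fun h => ?_).symm⟩
  refine Submodule.linearMap_qext _ (LinearMap.ext fun a => Subtype.ext ?_)
  exact indTrivLift_indTriv ρ g v hv h a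

end InducedTrivial

/-! ### Edge paths, chains and a criterion for homology coverings. -/

namespace OGraph

theorem IsWalk.append {Y : OGraph} {u v w : Y.V} {γ δ : List (Y.E × Bool)} (hγ : Y.IsWalk u γ v)
    (hδ : Y.IsWalk v δ w) : Y.IsWalk u (γ ++ δ) w := by
  induction γ generalizing u with
  | nil => obtain rfl : u = v := hγ; exact hδ
  | cons s γ ih => exact ⟨hγ.1, ih hγ.2⟩

theorem IsWalk.end_unique {Y : OGraph} {u v w : Y.V} {γ : List (Y.E × Bool)} (hv : Y.IsWalk u γ v)
    (hw : Y.IsWalk u γ w) : v = w := by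
  induction γ generalizing u with
  | nil => exact (show u = v from hv).symm.trans hw
  | cons s γ ih => exact ih hv.2 hw.2

theorem IsWalk.map {Y X : OGraph} (p : Hom Y X) {u v : Y.V} {γ : List (Y.E × Bool)}
    (h : Y.IsWalk u γ v) : X.IsWalk (p.onV u) (p.mapWalk γ) (p.onV v) := by
  induction γ generalizing u with
  | nil => exact congrArg p.onV h
  | cons s γ ih =>
    obtain ⟨e, b⟩ := s
    obtain ⟨h1, h2⟩ := h
    refine ⟨?_, ?_⟩
    · rw [← h1]
      cases b <;> simp [stepStart, p.src_onE, p.tgt_onE]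
    · have := ih h2
      cases b <;> simpa [Hom.mapWalk, stepEnd, p.src_onE, p.tgt_onE] using this

theorem chain_mapWalk (R : Type) [CommRing R] {Y X : OGraph} (p : Hom Y X)
    (γ : List (Y.E × Bool)) : chain R X (p.mapWalk γ) = p.chainMap R (chain R Y γ) := by
  induction γ with
  | nil => simp [chain, Hom.mapWalk]
  | cons s γ ih =>
    simp only [chain, Hom.mapWalk, List.map_cons, List.sum_cons, map_add] at ih ⊢
    rw [ih]
    simp [Hom.chainMap, Finsupp.mapDomain_single]

/-- A function on vertices whose increments along edges are pulled back from the base computes the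
value of the corresponding functional on images of edge paths. -/
theorem linearCombination_chain_mapWalk (R : Type) [CommRing R] {M : Type} [AddCommGroup M]
    [Module R M] {Y X : OGraph} (p : Hom Y X) (f : Y.V → M) (l : X.E → M)
    (hf : ∀ e, f (Y.tgt e) = f (Y.src e) + l (p.onE e)) {u v : Y.V} {γ : List (Y.E × Bool)}
    (h : Y.IsWalk u γ v) :
    Finsupp.linearCombination R l (chain R X (p.mapWalk γ)) = f v - f u := by
  have key : (Finsupp.linearCombination R l) ∘ₗ p.chainMap R =
      Finsupp.linearCombination R f ∘ₗ boundary R Y := by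
    ext e
    simp [Hom.chainMap, boundary, Finsupp.mapDomain_single, hf]
  have := congr($key (chain R Y γ))
  rw [LinearMap.comp_apply, LinearMap.comp_apply, boundary_chain R Y γ u v h,
    ← chain_mapWalk] at this
  simpa using this

/-- The potential `f` integrates the labels `l`, so `f v - f u` is the image of the mod-`m` chain
under a map that is injective by independence of `l`. Hence the chain vanishes exactly when `f u = f
v`. -/
theorem Hom.IsCovering.isModHomologyCovering {m : ℕ} {M : Type} [AddCommGroup M]
    [Module (ZMod m) M] {Y X : OGraph} {p : Hom Y X} (hp : p.IsCovering) (hY : Y.Connected)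
    (hX : X.Connected) (f : Y.V → M) (l : X.E → M) (hl : LinearIndependent (ZMod m) l)
    (hf : ∀ e, f (Y.tgt e) = f (Y.src e) + l (p.onE e))
    (hinj : ∀ u v, p.onV u = p.onV v → f u = f v → u = v) : p.IsModHomologyCovering m := by
  refine ⟨hp, hY, hX, fun u v γ h h' => ?_⟩
  have huv : p.onV u = p.onV v := h'.end_unique (h.map p)
  have key := linearCombination_chain_mapWalk (ZMod m) p f l hf h
  rw [Subtype.ext_iff]
  change _ ↔ chain (ZMod m) X (p.mapWalk γ) = 0
  rw [← map_eq_zero_iff _ hl, key, sub_eq_zero]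
  exact ⟨fun h => congrArg f h.symm, fun h => hinj u v huv h.symm⟩

theorem rose_connected (ι : Type) : (rose ι).Connected :=
  ⟨⟨()⟩, fun _ _ => ⟨[], rfl⟩⟩

/-! ### Cayley graphs as regular coverings of the rose. -/

section Cayley

variable {ι G H : Type} [Group G] [Group H]

/-- The Cayley graph of a group with respect to a family of elements. -/
abbrev cayley (s : ι → G) : OGraph where
  V := G
  E := G × ι
  src e := e.1
  tgt e := e.1 * s e.2

/-- The projection of a Cayley graph to the wedge of circles. -/
def cayleyHom (s : ι → G) : Hom (cayley s) (rose ι) where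
  onV _ := ()
  onE e := e.2
  src_onE _ := rfl
  tgt_onE _ := rfl

/-- The morphism of Cayley graphs induced by a group homomorphism. -/
def cayleyMap (s : ι → G) (t : ι → H) (f : G →* H) (hf : ∀ i, f (s i) = t i) :
    Hom (cayley s) (cayley t) where
  onV := f
  onE e := (f e.1, e.2)
  src_onE _ := rfl
  tgt_onE e := by simp [hf]

theorem cayleyHom_isCovering (s : ι → G) : (cayleyHom s).IsCovering := by
  refine ⟨fun v e _ => ⟨(v, e), ⟨rfl, rfl⟩, ?_⟩,
    fun v e _ => ⟨(v * (s e)⁻¹, e), ⟨inv_mul_cancel_right v (s e), rfl⟩, ?_⟩⟩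
  · rintro ⟨g, i⟩ ⟨rfl, rfl⟩
    rfl
  · rintro ⟨g, i⟩ ⟨rfl, rfl⟩
    exact Prod.ext (mul_inv_cancel_right g (s i)).symm rfl

theorem cayleyMap_isCovering (s : ι → G) (t : ι → H) (f : G →* H) (hf : ∀ i, f (s i) = t i) :
    (cayleyMap s t f hf).IsCovering := by
  refine ⟨fun v e he => ⟨(v, e.2), ⟨rfl, Prod.ext he.symm rfl⟩, ?_⟩,
    fun v e he => ⟨(v * (s e.2)⁻¹, e.2), ⟨inv_mul_cancel_right v (s e.2), ?_⟩, ?_⟩⟩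
  · rintro ⟨g, i⟩ ⟨rfl, rfl⟩
    rfl
  · refine Prod.ext ?_ rfl
    change f (v * (s e.2)⁻¹) = e.1
    rw [map_mul, map_inv, hf, mul_inv_eq_iff_eq_mul]
    exact he.symm
  · rintro ⟨g, i⟩ ⟨rfl, rfl⟩
    exact Prod.ext (mul_inv_cancel_right g (s i)).symm rfl

theorem cayley_connected {s : ι → G} (hs : Subgroup.closure (Set.range s) = ⊤) :
    (cayley s).Connected := by
  refine ⟨⟨1⟩, fun u v => ?_⟩
  have key : ∀ g ∈ Subgroup.closure (Set.range s), ∀ u, ∃ γ, (cayley s).IsWalk u γ (u * g) := by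
    intro g hg
    induction hg using Subgroup.closure_induction'' with
    | one => exact fun u => ⟨[], (mul_one u).symm⟩
    | mem x hx =>
      obtain ⟨i, rfl⟩ := hx
      exact fun u => ⟨[((u, i), true)], rfl, rfl⟩
    | inv_mem x hx =>
      obtain ⟨i, rfl⟩ := hx
      exact fun u => ⟨[((u * (s i)⁻¹, i), false)], inv_mul_cancel_right u (s i), rfl⟩
    | mul x y _ _ hx hy =>
      intro u
      obtain ⟨γ, hγ⟩ := hx u
      obtain ⟨δ, hδ⟩ := hy (u * x)
      exact ⟨γ ++ δ, mul_assoc u x y ▸ hγ.append hδ⟩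
  simpa using key (u⁻¹ * v) (hs ▸ Subgroup.mem_top _) u

/-- Left multiplication as a deck transformation of a Cayley graph. -/
def cayleyDeck (s : ι → G) : G →* (cayleyHom s).deck where
  toFun g := ⟨(Equiv.mulLeft g, (Equiv.mulLeft g).prodCongr (Equiv.refl ι)),
    fun _ => rfl, fun e => mul_assoc g e.1 (s e.2), fun _ => rfl, fun _ => rfl⟩
  map_one' := by ext <;> simp
  map_mul' g h := by ext <;> simp [mul_assoc]

theorem cayleyDeck_injective (s : ι → G) : Function.Injective (cayleyDeck s) := fun g h hgh => by
  have := congr(($hgh).1.1 1)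
  simpa [cayleyDeck] using this

/-- A deck transformation preserves labels, so it commutes with right multiplication by the
generators, hence by all of `G`. It is therefore left multiplication by the image of `1`. -/
theorem cayleyDeck_surjective {s : ι → G} (hs : Subgroup.closure (Set.range s) = ⊤) :
    Function.Surjective (cayleyDeck s) := by
  rintro ⟨⟨d, e⟩, h1, h2, -, h4⟩
  have he (g : G) (i : ι) : e (g, i) = (d g, i) := Prod.ext (h1 (g, i)) (h4 (g, i))
  have hd (g : G) (i : ι) : d (g * s i) = d g * s i := by
    have := h2 (g, i)
    simp only [he] at this
    exact this.symm
  have key : ∀ g ∈ Subgroup.closure (Set.range s), ∀ u, d (u * g) = d u * g := by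
    intro g hg
    induction hg using Subgroup.closure_induction'' with
    | one => simp
    | mem x hx =>
      obtain ⟨i, rfl⟩ := hx
      exact fun u => hd u i
    | inv_mem x hx =>
      obtain ⟨i, rfl⟩ := hx
      intro u
      rw [eq_mul_inv_iff_mul_eq, ← hd, inv_mul_cancel_right]
    | mul x y _ _ hx hy => intro u; rw [← mul_assoc, hy, hx, mul_assoc]
  have hmul (g : G) : d g = d 1 * g := by
    simpa using key g (hs ▸ Subgroup.mem_top _) 1
  refine ⟨d 1, Subtype.ext (Prod.ext (Equiv.ext fun g => (hmul g).symm)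
    (Equiv.ext fun x => ?_))⟩
  exact ((he x.1 x.2).trans (congrArg (·, x.2) (hmul x.1))).symm

theorem cayleyHom_isRegularCovering {s : ι → G} (hs : Subgroup.closure (Set.range s) = ⊤) :
    (cayleyHom s).IsRegularCovering :=
  ⟨cayleyHom_isCovering s, cayley_connected hs, rose_connected ι, fun u v _ =>
    ⟨_, (cayleyDeck s (v * u⁻¹)).2, inv_mul_cancel_right v u⟩⟩

/-- The deck group of the Cayley graph of a group is that group. -/
noncomputable def cayleyDeckEquiv {s : ι → G} (hs : Subgroup.closure (Set.range s) = ⊤) :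
    G ≃* (cayleyHom s).deck :=
  MulEquiv.ofBijective (cayleyDeck s) ⟨cayleyDeck_injective s, cayleyDeck_surjective hs⟩

end Cayley

end OGraph

/-! ### The two-stage tower and its deck group in a wreath product. -/

namespace OGraph

section Tower

/-- The elementary abelian group of rank two, written multiplicatively. -/
abbrev ModTwoSquare : Type := Multiplicative (Fin 2 → ZMod 2)

/-- The standard generators of the elementary abelian group. -/
def modTwoSquareGen (i : Fin 2) : ModTwoSquare := Multiplicative.ofAdd (Pi.single i 1)

theorem closure_modTwoSquareGen : Subgroup.closure (Set.range modTwoSquareGen) = ⊤ := by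
  have h : ∀ a : Fin 2 → ZMod 2, a = 0 ∨ a = Pi.single 0 1 ∨ a = Pi.single 1 1 ∨
      a = Pi.single 0 1 + Pi.single 1 1 := by decide
  have hmem (i) : modTwoSquareGen i ∈ Subgroup.closure (Set.range modTwoSquareGen) :=
    Subgroup.subset_closure ⟨i, rfl⟩
  refine eq_top_iff.2 fun a _ => ?_
  rcases h a.toAdd with h | h | h | h
  · exact (show a = 1 from h) ▸ one_mem _
  · exact (show a = modTwoSquareGen 0 from h) ▸ hmem 0
  · exact (show a = modTwoSquareGen 1 from h) ▸ hmem 1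
  · exact (show a = modTwoSquareGen 0 * modTwoSquareGen 1 from h) ▸ mul_mem (hmem 0) (hmem 1)

/-- The Magnus embedding of the generators in the wreath product. -/
def wreathGen (i : Fin 2) : RegularWreathProduct ModTwoSquare ModTwoSquare :=
  ⟨Pi.mulSingle 1 (modTwoSquareGen i), modTwoSquareGen i⟩

/-- The deck group of the iterated mod-2 homology covering of the wedge of two circles. -/
abbrev TowerGroup : Type := Subgroup.closure (Set.range wreathGen)

/-- The images of the two circles in the deck group of the tower. -/
def towerGen (i : Fin 2) : TowerGroup := ⟨wreathGen i, Subgroup.subset_closure ⟨i, rfl⟩⟩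

theorem closure_towerGen : Subgroup.closure (Set.range towerGen) = ⊤ := by
  rw [← Subgroup.closure_closure_coe_preimage (k := Set.range wreathGen)]
  congr 1
  ext ⟨g, hg⟩
  simp [towerGen, Subtype.ext_iff]

/-- The projection of the deck group of the tower to that of its lower stage. -/
def towerProj : TowerGroup →* ModTwoSquare :=
  RegularWreathProduct.rightHom.comp (Subgroup.subtype _)

theorem towerProj_towerGen (i : Fin 2) : towerProj (towerGen i) = modTwoSquareGen i := rfl

theorem lowerStage_isModHomologyCovering :
    (cayleyHom modTwoSquareGen).IsModHomologyCovering 2 := by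
  refine (cayleyHom_isCovering _).isModHomologyCovering (cayley_connected closure_modTwoSquareGen)
    (rose_connected _) (M := Fin 2 → ZMod 2) Multiplicative.toAdd (fun i => Pi.single i 1) ?_
    (fun _ => rfl) (fun _ _ _ h => h)
  exact Pi.linearIndependent_single_one (Fin 2) (ZMod 2)

/-- The `left` component of a group element is a mod-2 count of traversals of each edge `(q, j)` of
the lower graph. It serves as the potential, and together with the vertex below it determines the
element. -/
theorem upperStage_isModHomologyCovering :
    (cayleyMap towerGen modTwoSquareGen towerProj towerProj_towerGen).IsModHomologyCovering 2 := by
  classical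
  refine (cayleyMap_isCovering _ _ _ _).isModHomologyCovering (cayley_connected closure_towerGen)
    (cayley_connected closure_modTwoSquareGen) (M := ModTwoSquare × Fin 2 → ZMod 2)
    (fun g e => (g.1.left e.1).toAdd e.2) (fun e => Pi.single e 1) ?_ ?_ ?_
  · exact Pi.linearIndependent_single_one (ModTwoSquare × Fin 2) (ZMod 2)
  · rintro ⟨g, i⟩
    funext ⟨q, j⟩
    change (g.1.left q * (wreathGen i).left (g.1.right⁻¹ * q)).toAdd j =
      (g.1.left q).toAdd j + (Pi.single (g.1.right, i) 1 : ModTwoSquare × Fin 2 → ZMod 2) (q, j)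
    rw [toAdd_mul, Pi.add_apply]
    congr 1
    -- Multiplying by a generator changes only the coordinate of the edge that leaves the current
    -- lower vertex.
    by_cases h : q = g.1.right
    · subst h
      rw [inv_mul_cancel]
      simp [wreathGen, modTwoSquareGen, Pi.single_apply]
    · have h' : g.1.right⁻¹ * q ≠ 1 := fun h1 => h (inv_mul_eq_one.1 h1).symm
      simp [wreathGen, Pi.mulSingle_eq_of_ne h', h]
  · intro u v h1 h2
    refine Subtype.ext (RegularWreathProduct.ext ?_ h1)
    funext q
    exact congrArg Multiplicative.ofAdd (funext fun j => congrFun h2 (q, j))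

theorem towerGen_one_notMem : towerGen 1 ∉ Subgroup.zpowers (towerGen 0) := by
  rintro ⟨n, hn⟩
  have := congrArg towerProj hn
  simp only [map_zpow, towerProj_towerGen] at this
  have := congrFun (congrArg Multiplicative.toAdd this) 1
  simp [modTwoSquareGen] at this

end Tower

/-! ### The class `z` and the representation it generates. -/

section CosetCycle

variable {ι G : Type} [Group G]

open scoped Classical in
/-- The coefficients of `[G : ⟨x⟩] • 1_{⟨x⟩} - 1`. -/
noncomputable def cosetCoeff (x h : G) : ℤ :=
  (if h ∈ Subgroup.zpowers x then ((Subgroup.zpowers x).index : ℤ) else 0) - 1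

/-- This invariance gives both the cycle condition and the cancellation that rules out elevations.
-/
theorem cosetCoeff_mul_right (x h : G) : cosetCoeff x (h * x) = cosetCoeff x h := by
  simp only [cosetCoeff, mul_mem_cancel_right (Subgroup.mem_zpowers x)]

theorem cosetCoeff_inv_mul (x h : G) : cosetCoeff x (x⁻¹ * h) = cosetCoeff x h := by
  simp only [cosetCoeff, mul_mem_cancel_left (inv_mem (Subgroup.mem_zpowers x))]

theorem cosetCoeff_inv (x h : G) : cosetCoeff x h⁻¹ = cosetCoeff x h := by
  simp only [cosetCoeff, inv_mem_iff]

theorem sum_cosetCoeff [Fintype G] (x : G) : ∑ h, cosetCoeff x h = 0 := by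
  classical
  simp only [cosetCoeff, Finset.sum_sub_distrib, ← Finset.sum_filter, Finset.sum_const]
  rw [← Fintype.card_subtype, ← Nat.card_eq_fintype_card, Finset.card_univ,
    ← Nat.card_eq_fintype_card, ← (Subgroup.zpowers x).card_mul_index]
  simp

/-- The 1-chain of the Cayley graph supported on the edges labelled `i` with coefficients
`cosetCoeff (s i)`. -/
noncomputable def cosetChain [Fintype G] (s : ι → G) (i : ι) : (cayley s).E →₀ ℤ :=
  ∑ h, Finsupp.single (h, i) (cosetCoeff (s i) h)

theorem cosetChain_apply [Fintype G] (s : ι → G) (i : ι) (h : G) :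
    cosetChain s i (h, i) = cosetCoeff (s i) h := by
  classical
  simp [cosetChain, Finsupp.finsetSum_apply, Finsupp.single_apply]

theorem boundary_cosetChain [Fintype G] (s : ι → G) (i : ι) :
    boundary ℤ (cayley s) (cosetChain s i) = 0 := by
  rw [cosetChain, map_sum]
  simp only [boundary, Finsupp.linearCombination_single, smul_sub, Finset.sum_sub_distrib]
  rw [sub_eq_zero, ← Equiv.sum_comp (Equiv.mulRight (s i))
    fun h => cosetCoeff (s i) h • Finsupp.single (cayley s |>.src (h, i)) (1 : ℤ)]
  simp [cosetCoeff_mul_right]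

/-- The class `[G : ⟨s i⟩] • e - ∑ e'`, where `e` is the cycle of the powers of `s i` and `e'` runs
over the distinct translates of `e`. -/
noncomputable def cosetCycle [Fintype G] (s : ι → G) (i : ι) : H1 ℤ (cayley s) :=
  ⟨cosetChain s i, boundary_cosetChain s i⟩

theorem mapH1_cosetCycle [Fintype G] (s : ι → G) (i : ι) :
    (cayleyHom s).mapH1 ℤ (cosetCycle s i) = 0 := by
  refine Subtype.ext ?_
  change Finsupp.mapDomain (cayleyHom s).onE (cosetChain s i) = 0
  rw [cosetChain, Finsupp.mapDomain_finsetSum]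
  simp only [Finsupp.mapDomain_single]
  change ∑ h, Finsupp.single i (cosetCoeff (s i) h) = 0
  rw [← Finsupp.single_finsetSum, sum_cosetCoeff, Finsupp.single_zero]

/-- The coefficient at an edge outside `⟨s i⟩` is `-1`, and `m` divides it. -/
theorem isUnit_of_cosetCycle_eq_smul [Fintype G] {s : ι → G} {i : ι} {h : G}
    (hh : h ∉ Subgroup.zpowers (s i)) (m : ℤ) (z : H1 ℤ (cayley s))
    (hz : cosetCycle s i = m • z) : IsUnit m := by
  have h1 := congr(($hz).1 (h, i))
  change cosetChain s i (h, i) = m * z.1 (h, i) at h1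
  rw [cosetChain_apply, cosetCoeff, if_neg hh] at h1
  exact IsUnit.of_mul_eq_one (-z.1 (h, i)) (by linarith)

theorem deckRep_cosetCycle [Fintype G] (s : ι → G) (i : ι) (g : G) :
    ((cayleyHom s).deckRep ℂ (cayleyDeck s g) (fromInt ℂ (cayley s) (cosetCycle s i))).1 =
      ∑ h, Finsupp.single (h, i) (cosetCoeff (s i) (g⁻¹ * h) : ℂ) := by
  change Finsupp.mapDomain (fun e : G × ι => (g * e.1, e.2))
    (Finsupp.mapRange.addMonoidHom (Int.castAddHom ℂ) (cosetChain s i)) = _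
  rw [cosetChain, map_sum, Finsupp.mapDomain_finsetSum, ← Equiv.sum_comp (Equiv.mulLeft g)
    fun h => Finsupp.single (h, i) (cosetCoeff (s i) (g⁻¹ * h) : ℂ)]
  simp [Finsupp.mapRange_single, Finsupp.mapDomain_single]

theorem isIsoQuotientByTriv_cosetCycle [Fintype G] {s : ι → G}
    (hs : Subgroup.closure (Set.range s) = ⊤) (i : ι) :
    IsIsoQuotientByTriv (W := (orbitSpan ((cayleyHom s).deckRep ℂ)
      (fromInt ℂ (cayley s) (cosetCycle s i))).toSubmodule) (orbitSpan ((cayleyHom s).deckRep ℂ)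
      (fromInt ℂ (cayley s) (cosetCycle s i))).toRepresentation
      (indTriv (cayleyDeckEquiv hs (s i))) := by
  classical
  let _ : Fintype (cayleyHom s).deck := Fintype.ofEquiv G (cayleyDeckEquiv hs).toEquiv
  have hrep (g : G) : ((cayleyHom s).deckRep ℂ (cayleyDeckEquiv hs g)
      (fromInt ℂ (cayley s) (cosetCycle s i))).1 =
      ∑ h, Finsupp.single (h, i) (cosetCoeff (s i) (g⁻¹ * h) : ℂ) := deckRep_cosetCycle s i g
  have hmap : Subgroup.zpowers (cayleyDeckEquiv hs (s i)) =
      (Subgroup.zpowers (s i)).map (cayleyDeckEquiv hs : G ≃* _).toMonoidHom :=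
    (MonoidHom.map_zpowers (cayleyDeckEquiv hs).toMonoidHom (s i)).symm
  have hmem (g : G) : cayleyDeckEquiv hs g ∈ Subgroup.zpowers (cayleyDeckEquiv hs (s i)) ↔
      g ∈ Subgroup.zpowers (s i) := by
    rw [hmap]
    exact Subgroup.mem_map_iff_mem (cayleyDeckEquiv hs).injective
  have hindex : (Subgroup.zpowers (cayleyDeckEquiv hs (s i))).index =
      (Subgroup.zpowers (s i)).index := by
    rw [hmap]
    exact Subgroup.index_map_equiv _ (cayleyDeckEquiv hs)
  have hl (g : G) : ((cayleyHom s).deckRep ℂ (cayleyDeckEquiv hs g)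
      (fromInt ℂ (cayley s) (cosetCycle s i))).1 (1, i) = cosetCoeff (s i) g := by
    rw [hrep, ← cosetCoeff_inv]
    simp [Finsupp.finsetSum_apply, Finsupp.single_apply]
  refine isIsoQuotientByTriv_orbitSpan _ _ _ (Subtype.ext ?_) (Subtype.ext ?_)
    -- The separating functional is the coefficient at the base edge `(1, i)`.
    (Finsupp.lapply (1, i) ∘ₗ Submodule.subtype _) ?_ ?_
  · have h1 := hrep 1
    rw [map_one, map_one] at h1
    rw [hrep]
    refine Eq.trans ?_ h1.symm
    simp only [cosetCoeff_inv_mul, inv_one, one_mul]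
  · rw [← Equiv.sum_comp (cayleyDeckEquiv hs).toEquiv, AddSubmonoidClass.coe_finsetSum]
    simp only [MulEquiv.toEquiv_eq_coe, EquivLike.coe_coe]
    rw [Finset.sum_congr rfl fun g _ => hrep g, Finset.sum_comm]
    refine Finset.sum_eq_zero fun h _ => ?_
    -- The substitution `g ↦ h * g⁻¹` turns the coefficient into `cosetCoeff (s i) g`, whose total
    -- is zero.
    rw [← Finsupp.single_finsetSum, ← Equiv.sum_comp ((Equiv.inv G).trans (Equiv.mulLeft h))]
    simp [← Int.cast_sum, sum_cosetCoeff]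
  · intro d hd
    obtain ⟨g, rfl⟩ := (cayleyDeckEquiv hs).surjective d
    refine (hl g).trans ?_
    rw [cosetCoeff, if_pos ((hmem g).1 hd), hindex]
    simp
  · intro d hd
    obtain ⟨g, rfl⟩ := (cayleyDeckEquiv hs).surjective d
    refine (hl g).trans ?_
    rw [cosetCoeff, if_neg (mt (hmem g).2 hd)]
    simp

end CosetCycle

end OGraph

/-! ### Free group actions that compute weights of edge paths. -/

namespace OGraph

section Cocycle

variable {ι G : Type} [Group G]

/-- A right action of the free group on `T` that covers the moves along the edges of a Cayley graph
with accumulated weight computes the endpoint and the total weight of every edge path. -/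
theorem IsWalk.action_apply {T M : Type} [AddCommGroup M] {s : ι → G}
    (π : FreeGroup ι →* (Equiv.Perm T)ᵐᵒᵖ) (τ : G → M → T) (l : G × ι → M)
    (hstep : ∀ u i m, (π (FreeGroup.of i)).unop (τ u m) = τ (u * s i) (m + l (u, i)))
    {u v : G} {γ : List ((G × ι) × Bool)} (h : (cayley s).IsWalk u γ v) (m : M) :
    (π (FreeGroup.mk ((cayleyHom s).mapWalk γ))).unop (τ u m) =
      τ v (m + Finsupp.linearCombination ℤ l (chain ℤ (cayley s) γ)) := by
  induction γ generalizing u m with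
  | nil =>
    obtain rfl : u = v := h
    have : FreeGroup.mk ((cayleyHom s).mapWalk []) = 1 := rfl
    rw [this, map_one]
    simp [chain]
  | cons a γ ih =>
    obtain ⟨⟨g, i⟩, b⟩ := a
    obtain ⟨h1, h2⟩ := h
    have hmk : FreeGroup.mk ((cayleyHom s).mapWalk (((g, i), b) :: γ)) =
        FreeGroup.mk [(i, b)] * FreeGroup.mk ((cayleyHom s).mapWalk γ) := rfl
    have hchain : chain ℤ (cayley s) (((g, i), b) :: γ) =
        Finsupp.single (g, i) (if b then (1 : ℤ) else -1) + chain ℤ (cayley s) γ := by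
      simp [chain]
    rw [hmk, map_mul, MulOpposite.unop_mul, Equiv.Perm.mul_apply, hchain, map_add, ← add_assoc,
      ← ih h2]
    congr 1
    rw [Finsupp.linearCombination_single]
    cases b
    · obtain rfl : g * s i = u := h1
      have hinv : FreeGroup.mk [(i, false)] = (FreeGroup.of i)⁻¹ := rfl
      rw [hinv, map_inv, MulOpposite.unop_inv, Equiv.Perm.inv_eq_iff_eq]
      change _ = (π (FreeGroup.of i)).unop (τ g _)
      rw [hstep]
      simp
    · obtain rfl : g = u := h1
      change (π (FreeGroup.of i)).unop _ = τ (g * s i) _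
      rw [hstep]
      simp

/-- Edge paths of a Cayley graph that spell the trivial element of the free group have trivial
1-chain. -/
theorem IsWalk.chain_eq_zero {s : ι → G} {u v : G} {γ : List ((G × ι) × Bool)}
    (h : (cayley s).IsWalk u γ v) (hγ : FreeGroup.mk ((cayleyHom s).mapWalk γ) = 1) :
    chain ℤ (cayley s) γ = 0 := by
  -- The universal weight: the second component records every edge traversed, so a word equal to `1`
  -- must return it to its initial value.
  let step (i : ι) : Equiv.Perm (G × (G × ι →₀ ℤ)) :=
    { toFun := fun x => (x.1 * s i, x.2 + Finsupp.single (x.1, i) 1)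
      invFun := fun x => (x.1 * (s i)⁻¹, x.2 - Finsupp.single (x.1 * (s i)⁻¹, i) 1)
      left_inv := fun x => by simp
      right_inv := fun x => by simp }
  have key := h.action_apply (FreeGroup.lift fun i => MulOpposite.op (step i)) Prod.mk
    (fun e => Finsupp.single e 1) (fun u i m => by simp [step]) 0
  rw [hγ, map_one] at key
  have h2 := (Prod.ext_iff.1 key).2
  have h3 : Finsupp.linearCombination ℤ (fun e : G × ι => Finsupp.single e (1 : ℤ)) =
      LinearMap.id := by
    ext; simp
  rw [h3] at h2
  simpa using h2.symm

end Cocycle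

/-! ### The infinite dihedral obstruction to being an elevation. -/

/-- The action of the signs on the integers. -/
def signAction : ℤˣ →* MulAut (Multiplicative ℤ) where
  toFun u :=
    { toFun := fun a => Multiplicative.ofAdd (u * a.toAdd)
      invFun := fun a => Multiplicative.ofAdd (u * a.toAdd)
      left_inv := fun a => congrArg Multiplicative.ofAdd (by
        rw [toAdd_ofAdd, ← mul_assoc, ← Units.val_mul, Int.units_mul_self, Units.val_one, one_mul]
        rfl)
      right_inv := fun a => congrArg Multiplicative.ofAdd (by
        rw [toAdd_ofAdd, ← mul_assoc, ← Units.val_mul, Int.units_mul_self, Units.val_one, one_mul]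
        rfl)
      map_mul' := fun a b => by simp [mul_add] }
  map_one' := by ext; simp
  map_mul' u v := by ext; simp; ring

/-- The group of affine automorphisms `n ↦ ± n + b` of the integers. -/
abbrev AffineInt : Type :=
  Multiplicative ℤ ⋊[signAction] ℤˣ

theorem AffineInt.toAdd_mul_left (a b : AffineInt) :
    (a * b).left.toAdd = a.left.toAdd + a.right * b.left.toAdd := rfl

theorem AffineInt.pow_of_right_eq_one {a : AffineInt} (ha : a.right = 1) (k : ℕ) :
    (a ^ k).right = 1 ∧ (a ^ k).left.toAdd = k * a.left.toAdd := by
  induction k with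
  | zero => simp
  | succ k ih =>
    rw [pow_succ]
    refine ⟨by simp [ih.1, ha], ?_⟩
    rw [AffineInt.toAdd_mul_left, ih.1, ih.2]
    push_cast
    ring

/-- The commutator of two distinct elements of a basis maps to a nontrivial translation under a
homomorphism to the infinite dihedral group that sends a given element of another basis to a
reflection. -/
theorem exists_hom_affineInt {ι : Type} (b : FreeGroupBasis ι (FreeGroup (Fin 2))) {i j : ι}
    (hij : i ≠ j) : ∃ f : FreeGroup (Fin 2) →* AffineInt,
      (f (FreeGroup.of 0)).right = -1 ∧ (f (b i * b j * (b i)⁻¹ * (b j)⁻¹)).right = 1 ∧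
      (f (b i * b j * (b i)⁻¹ * (b j)⁻¹)).left.toAdd ≠ 0 := by
  classical
  let r : AffineInt := ⟨1, -1⟩
  let t : AffineInt := ⟨Multiplicative.ofAdd 1, 1⟩
  -- The two assignments swap the roles of `b i` and `b j`. Either way the commutator becomes
  -- translation by `±2`.
  let f₁ := b.lift fun k => if k = i then r else if k = j then t else 1
  let f₂ := b.lift fun k => if k = j then r else if k = i then t else 1
  have hb (φ : ι → AffineInt) (k : ι) : b.lift φ (b k) = φ k := by simp
  have h₁i : f₁ (b i) = r := by simp [f₁, hb]
  have h₁j : f₁ (b j) = t := by simp [f₁, hb, hij.symm]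
  have h₂i : f₂ (b i) = t := by simp [f₂, hb, hij]
  have h₂j : f₂ (b j) = r := by simp [f₂, hb]
  let ε₁ : FreeGroup (Fin 2) →* ℤˣ := SemidirectProduct.rightHom.comp f₁
  let ε₂ : FreeGroup (Fin 2) →* ℤˣ := SemidirectProduct.rightHom.comp f₂
  have e₁i : ε₁ (b i) = -1 := by simp [ε₁, h₁i, r]
  have e₂i : ε₂ (b i) = 1 := by simp [ε₂, h₂i, t]
  have e₂j : ε₂ (b j) = -1 := by simp [ε₂, h₂j, r]
  have hne (ε ε' : FreeGroup (Fin 2) →* ℤˣ) (h0 : ε (.of 0) = ε' (.of 0))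
      (h1 : ε (.of 1) = ε' (.of 1)) : ε = ε' := by
    ext k
    fin_cases k
    · exact congrArg Units.val h0
    · exact congrArg Units.val h1
  by_cases c₁ : ε₁ (.of 0) = -1
  · refine ⟨f₁, c₁, ?_, ?_⟩
    · simp [h₁i, h₁j, r, t]
    · rw [map_mul, map_mul, map_mul, map_inv, map_inv, h₁i, h₁j]
      decide
  by_cases c₂ : ε₂ (.of 0) = -1
  · refine ⟨f₂, c₂, ?_, ?_⟩
    · simp [h₂i, h₂j, r, t]
    · rw [map_mul, map_mul, map_mul, map_inv, map_inv, h₂i, h₂j]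
      decide
  -- Otherwise both sign characters are trivial on the first generator. Being nontrivial, both are
  -- `-1` on the second, so they coincide, yet they differ at `b i`.
  exfalso
  have d₁ := (Int.units_eq_one_or _).resolve_right c₁
  have d₂ := (Int.units_eq_one_or _).resolve_right c₂
  rcases Int.units_eq_one_or (ε₁ (.of 1)) with k₁ | k₁
  · rw [hne ε₁ 1 d₁ k₁] at e₁i
    exact absurd e₁i (show (1 : ℤˣ) ≠ -1 by decide)
  rcases Int.units_eq_one_or (ε₂ (.of 1)) with k₂ | k₂
  · rw [hne ε₂ 1 d₂ k₂] at e₂j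
    exact absurd e₂j (show (1 : ℤˣ) ≠ -1 by decide)
  rw [hne ε₁ ε₂ (d₁.trans d₂.symm) (k₁.trans k₂.symm), e₂i] at e₁i
  exact absurd e₁i (by decide)

theorem exists_hom_modTwoSquare (e : Fin 2 → ℤˣ) :
    ∃ δ : ModTwoSquare →* ℤˣ, ∀ i, δ (modTwoSquareGen i) = e i := by
  refine ⟨{ toFun := fun a => e 0 ^ a.toAdd 0 * e 1 ^ a.toAdd 1
            map_one' := by simp
            map_mul' := fun a b => by
              simp only [toAdd_mul, Pi.add_apply, uzpow_add]
              exact mul_mul_mul_comm _ _ _ _ }, fun i => ?_⟩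
  fin_cases i <;> simp [modTwoSquareGen]

/-- The class `cosetCycle s 0` is not represented by an elevation of a primitive commutator, as long
as the Cayley graph covers the mod-2 homology covering. -/
theorem cosetCycle_ne_loopClass_elevation {G : Type} [Group G] [Fintype G] {s : Fin 2 → G}
    (pr : G →* ModTwoSquare) (hpr : ∀ i, pr (s i) = modTwoSquareGen i)
    (h0 : cosetCycle s 0 ≠ 0) {w : List (Fin 2 × Bool)}
    (hw : IsPrimitiveCommutator (FreeGroup.mk w)) {y : G} {γ : List ((G × Fin 2) × Bool)}
    (h : (cayley s).IsWalk y γ y) (he : (cayleyHom s).IsElevation w y γ) :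
    loopClass ℤ (cayley s) γ y h ≠ cosetCycle s 0 := by
  intro hz
  have hchain : chain ℤ (cayley s) γ = cosetChain s 0 := congrArg Subtype.val hz
  obtain ⟨-, k, hk, hmap, -⟩ := he
  have hmk : FreeGroup.mk ((cayleyHom s).mapWalk γ) = FreeGroup.mk w ^ k := by
    rw [FreeGroup.pow_mk, hmap]
  obtain ⟨ι, b, i, j, hc⟩ := hw
  -- `IsPrimitiveCommutator` admits `i = j`, where the commutator is trivial.
  by_cases hij : i = j
  · subst hij
    refine h0 (Subtype.ext (hchain.symm.trans (h.chain_eq_zero ?_)))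
    rw [hmk, hc]
    simp
  obtain ⟨f, hf0, hf1, hf2⟩ := exists_hom_affineInt b hij
  rw [← hc] at hf1 hf2
  obtain ⟨δ, hδ⟩ := exists_hom_modTwoSquare fun i => (f (FreeGroup.of i)).right
  let l (e : G × Fin 2) : ℤ := δ (pr e.1) * (f (FreeGroup.of e.2)).left.toAdd
  -- Words are read from left to right, so the group acts by right multiplication, which reverses
  -- composition and calls for the opposite group.
  let π : FreeGroup (Fin 2) →* (Equiv.Perm AffineInt)ᵐᵒᵖ :=
    { toFun := fun g => MulOpposite.op (Equiv.mulRight (f g))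
      map_one' := by simp
      map_mul' := fun g g' => by simp }
  have key := h.action_apply π (fun u m => ⟨Multiplicative.ofAdd m, δ (pr u)⟩) l (fun u i m => by
    refine SemidirectProduct.ext rfl ?_
    change δ (pr u) * (f (FreeGroup.of i)).right = δ (pr (u * s i))
    rw [map_mul, map_mul, hpr, hδ]) 0
  have hl : Finsupp.linearCombination ℤ l (chain ℤ (cayley s) γ) = 0 := by
    rw [hchain, cosetChain, map_sum]
    simp only [Finsupp.linearCombination_single]
    -- Right translation by `s 0` fixes the coefficients and negates `l`, since `f` sends the first
    -- generator to a reflection.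
    have hneg : ∑ g, cosetCoeff (s 0) g • l (g, 0) = -∑ g, cosetCoeff (s 0) g • l (g, 0) := by
      nth_rewrite 1 [← Equiv.sum_comp (Equiv.mulRight (s 0))]
      rw [← Finset.sum_neg_distrib]
      refine Finset.sum_congr rfl fun g _ => ?_
      simp [l, cosetCoeff_mul_right, hpr, hδ, hf0]
    linarith
  rw [hl, hmk, map_pow] at key
  have key' := congrArg (fun a : AffineInt => a.left.toAdd) key
  -- The translation part of this product is `δ (pr y) * k` times that of `f` at the commutator,
  -- which is nonzero although `hl` makes it vanish.
  have hπ : (π (FreeGroup.mk w) ^ k).unop (⟨Multiplicative.ofAdd 0, δ (pr y)⟩ : AffineInt) =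
      ⟨Multiplicative.ofAdd 0, δ (pr y)⟩ * f (FreeGroup.mk w) ^ k := by
    rw [← map_pow, ← map_pow]
    rfl
  rw [hπ] at key'
  simp only [AffineInt.toAdd_mul_left, (AffineInt.pow_of_right_eq_one hf1 k).2] at key'
  simp [hk.ne', hf2] at key'

end OGraph

/-! ### Assembly of the tower and the class. -/

theorem proposition1p3 :
    ∃ (Z Y : OGraph) (p₁ : OGraph.Hom Z (OGraph.rose (Fin 2))) (p₂ : OGraph.Hom Y Z)
      (p : OGraph.Hom Y (OGraph.rose (Fin 2))),
      p = p₁.comp p₂ ∧ p₁.IsModHomologyCovering 2 ∧ p₂.IsModHomologyCovering 2 ∧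
      Finite Y.V ∧ Finite Y.E ∧ p.IsRegularCovering ∧
      ∃ z : OGraph.H1 ℤ Y,
        p.mapH1 ℤ z = 0 ∧
        (∀ (m : ℤ) (z₀ : OGraph.H1 ℤ Y), z = m • z₀ → IsUnit m) ∧
        (∃ g : p.deck,
          IsIsoQuotientByTriv
            (orbitSpan (p.deckRep ℂ) (OGraph.fromInt ℂ Y z)).toRepresentation (indTriv g)) ∧
        ¬ ∃ w : List (Fin 2 × Bool), IsPrimitiveCommutator (FreeGroup.mk w) ∧
          ∃ (y : Y.V) (γ : List (Y.E × Bool)) (h : Y.IsWalk y γ y),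
            p.IsElevation w y γ ∧ OGraph.loopClass ℤ Y γ y h = z := by
  have := Fintype.ofFinite OGraph.TowerGroup
  have hunit := OGraph.isUnit_of_cosetCycle_eq_smul OGraph.towerGen_one_notMem
  have h0 : OGraph.cosetCycle OGraph.towerGen 0 ≠ 0 := fun h => by
    have := hunit 0 0 (by rw [h, zero_smul])
    exact not_isUnit_zero this
  refine ⟨OGraph.cayley OGraph.modTwoSquareGen, OGraph.cayley OGraph.towerGen, OGraph.cayleyHom _,
    OGraph.cayleyMap _ _ OGraph.towerProj OGraph.towerProj_towerGen, OGraph.cayleyHom _, rfl,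
    OGraph.lowerStage_isModHomologyCovering, OGraph.upperStage_isModHomologyCovering,
    inferInstanceAs (Finite OGraph.TowerGroup), inferInstanceAs (Finite (OGraph.TowerGroup × Fin 2)),
    OGraph.cayleyHom_isRegularCovering OGraph.closure_towerGen,
    OGraph.cosetCycle OGraph.towerGen 0, OGraph.mapH1_cosetCycle _ _, hunit,
    ⟨_, OGraph.isIsoQuotientByTriv_cosetCycle OGraph.closure_towerGen 0⟩, ?_⟩
  rintro ⟨w, hw, y, γ, h, he, hz⟩
  exact OGraph.cosetCycle_ne_loopClass_elevation OGraph.towerProj OGraph.towerProj_towerGen h0 hw h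
    he hz
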